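/- **Theorem 1 (Sign Product Embedding of DROP Sketches).** There are absolute constants $C, c > 0$ such that the following holds. Let $n, k, m$ be natural numbers with $1 \le k \le n$, let $0 < \delta < 1$, let $u \in \mathbb R^n$ be a fixed unit vector, and put $\kappa = \pi/4$. Let $a_0, \dots, a_{2m-1}$ be independent standard Gaussian vectors $\mathcal N(0, I_n)$, and let $\mathcal B : \mathbb R^n \to \mathbb R^m$ be the debiased rank-one projection $$\mathcal B(x) = \big( \langle a_{2i}, x\rangle^2 - \langle a_{2i+1}, x\rangle^2 \big)_{i=0}^{m-1}.$$ If $$m \ \ge\ C \delta^{-2} k \log\Big(\frac{n}{k\delta}\Big) \qquad\text{and}\qquad m \ge C k$$ (the second condition follows from the first whenever $n \ge e\,k\delta$), then, with probability exceeding $1 - C\exp(-c\,\delta^2 m)$, all $x \in \mathbb R^n$ with at most $k$ nonzero entries satisfy simultaneously $$\Big| \frac{\kappa}{m} \big\langle \operatorname{sign}(\mathcal B(u)), \mathcal B(x)\big\rangle - \langle u, x\rangle^2 \Big| \le \delta \|x\|^2,$$ where $\operatorname{sign}$ is applied componentwise. -/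

import Mathlib

open MeasureTheory ProbabilityTheory

noncomputable section

/-- The quadratic (rank-one) sketch `x ↦ (⟨a i, x⟩ ^ 2) i` for sketching vectors `a i`. -/
def quadSketch {M n : ℕ} (a : Fin M → EuclideanSpace ℝ (Fin n))
    (x : EuclideanSpace ℝ (Fin n)) : Fin M → ℝ :=
  fun i => (inner ℝ (a i) x) ^ 2

/-- The debiased sketch with `m` components: component `i` is the difference of components
`2 * i` and `2 * i + 1` of the quadratic sketch (all indices start at `0`). -/
def debiasedSketch {m n : ℕ} (a : Fin (2 * m) → EuclideanSpace ℝ (Fin n))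
    (x : EuclideanSpace ℝ (Fin n)) : Fin m → ℝ :=
  fun i => quadSketch a x ⟨2 * i, by omega⟩ - quadSketch a x ⟨2 * i + 1, by omega⟩

/-- The set of `k`-sparse vectors of `ℝⁿ`. -/
def sparseVectors (n k : ℕ) : Set (EuclideanSpace ℝ (Fin n)) :=
  {x | (Finset.univ.filter (fun i => x i ≠ 0)).card ≤ k}

/-- The sign operator applied componentwise. -/
def signVec {m : ℕ} (y : Fin m → ℝ) : Fin m → ℝ := fun i => Real.sign (y i)

end

/-! For fixed `u` and `a` the error of the embedding is a quadratic form in `x`, because the signs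
depend on `u` alone. So it need only be controlled on a finite net, which rests on three facts.

Expectation: write `x = ρ u + w` with `w ⊥ u`. The projections of a Gaussian on `u` and `w` are
independent. The cross term vanishes because the `w` projection is centred, the `w²` term because
the sign is antisymmetric in the two vectors. What remains is `ρ² E|X² - Y²| = (4/π) ρ²`, which `κ =
π/4` normalises (`integral_sign_mul_sub_stdGaussian`).

Concentration: each centred summand is dominated by a sum of two squared Gaussians plus a constant,
so it has an exponential moment and Bernstein's inequality applies
(`measure_abs_sum_ge_le_of_abs_le`).

Uniformity: a `1/4`-net on the unit sphere of each `k`-dimensional coordinate subspace controls any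
quadratic form up to a factor 4 (`exists_net_sparseVectors`). The sample size makes the union bound
over this net cost only half of the Bernstein exponent. -/

/-! ### Nets and quadratic forms on sparse vectors -/

/-- A volume argument: a `1/4`-separated subset of the unit ball has at most `9 ^ dim` points. -/
theorem card_le_nine_pow_of_separated {E : Type*} [NormedAddCommGroup E] [NormedSpace ℝ E]
    [FiniteDimensional ℝ E] (s : Finset E) (hs : ∀ c ∈ s, ‖c‖ ≤ 1)
    (h : ∀ c ∈ s, ∀ d ∈ s, c ≠ d → 1 / 4 ≤ ‖c - d‖) :
    s.card ≤ 9 ^ Module.finrank ℝ E := by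
  borelize E
  let μ : Measure E := Measure.addHaar
  -- Balls of half the separation are disjoint and lie in the ball of radius `1 + 1/8`; the ratio of
  -- radii is 9.
  let δ : ℝ := 1 / 8
  let ρ : ℝ := 9 / 8
  have hδ : 0 < δ := by norm_num [δ]
  have hρ : 0 < ρ := by norm_num [ρ]
  have hdisj : Set.Pairwise (s : Set E)
      (Function.onFun Disjoint fun c => Metric.ball (c : E) δ) := by
    rintro c hc d hd hcd
    apply Metric.ball_disjoint_ball
    rw [dist_eq_norm]
    refine le_trans ?_ (h c hc d hd hcd)
    norm_num [δ]
  have hsub : (⋃ c ∈ s, Metric.ball (c : E) δ) ⊆ Metric.ball (0 : E) ρ := by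
    refine Set.iUnion₂_subset fun x hx => Metric.ball_subset_ball' ?_
    have := hs x hx
    rw [dist_zero_right]
    simp only [δ, ρ]
    linarith
  have hvol : (s.card : ENNReal) * ENNReal.ofReal (δ ^ Module.finrank ℝ E) *
      μ (Metric.ball 0 1) ≤
        ENNReal.ofReal (ρ ^ Module.finrank ℝ E) * μ (Metric.ball 0 1) := by
    calc (s.card : ENNReal) * ENNReal.ofReal (δ ^ Module.finrank ℝ E) * μ (Metric.ball 0 1)
        = μ (⋃ c ∈ s, Metric.ball (c : E) δ) := by
          rw [measure_biUnion_finset hdisj fun c _ => measurableSet_ball]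
          simp only [μ.addHaar_ball_of_pos _ hδ, Finset.sum_const, nsmul_eq_mul, mul_assoc]
      _ ≤ μ (Metric.ball (0 : E) ρ) := measure_mono hsub
      _ = _ := by rw [μ.addHaar_ball_of_pos _ hρ]
  have hle : (s.card : ENNReal) * ENNReal.ofReal (δ ^ Module.finrank ℝ E) ≤
      ENNReal.ofReal (ρ ^ Module.finrank ℝ E) :=
    (ENNReal.mul_le_mul_iff_left (Metric.measure_ball_pos _ _ zero_lt_one).ne'
      measure_ball_lt_top.ne).1 hvol
  have hK : (s.card : ℝ) ≤ (9 : ℝ) ^ Module.finrank ℝ E := by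
    have := ENNReal.toReal_le_of_le_ofReal (pow_nonneg hρ.le _) hle
    rw [ENNReal.toReal_mul, ENNReal.toReal_natCast,
      ENNReal.toReal_ofReal (pow_nonneg hδ.le _)] at this
    rw [show (9 : ℝ) = ρ / δ by norm_num [ρ, δ], div_pow, le_div_iff₀ (pow_pos hδ _)]
    exact this
  exact mod_cast hK

/-- The unit sphere of a subspace has a `1/4`-net with at most `9 ^ dim` points. -/
theorem exists_quarter_net_sphere {E : Type*} [NormedAddCommGroup E] [NormedSpace ℝ E]
    (F : Submodule ℝ E) [FiniteDimensional ℝ F] :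
    ∃ s : Finset E, s.card ≤ 9 ^ Module.finrank ℝ F ∧ (∀ y ∈ s, ‖y‖ = 1 ∧ y ∈ F) ∧
      ∀ x ∈ F, ‖x‖ = 1 → ∃ y ∈ s, ‖x - y‖ ≤ 1 / 4 := by
  classical
  -- A separated set of maximal size is a net: any point far from it could be added.
  let S : Set ℕ := {N | ∃ s : Finset F, s.card = N ∧ (∀ y ∈ s, ‖y‖ = 1) ∧
    ∀ c ∈ s, ∀ d ∈ s, c ≠ d → 1 / 4 ≤ ‖c - d‖}
  have hbdd : BddAbove S := by
    refine ⟨9 ^ Module.finrank ℝ F, ?_⟩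
    rintro _ ⟨s, rfl, h1, h2⟩
    exact card_le_nine_pow_of_separated s (fun c hc => (h1 c hc).le) h2
  have hne : S.Nonempty := ⟨0, ∅, by simp⟩
  obtain ⟨s, hs, h1, h2⟩ := Nat.sSup_mem hne hbdd
  refine ⟨s.map (Function.Embedding.subtype _), ?_, ?_, ?_⟩
  · rw [Finset.card_map]
    exact card_le_nine_pow_of_separated s (fun c hc => (h1 c hc).le) h2
  · intro y hy
    obtain ⟨z, hz, rfl⟩ := Finset.mem_map.1 hy
    exact ⟨h1 z hz, z.2⟩
  · intro x hxF hx
    by_contra! hcon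
    have hfar : ∀ z ∈ s, 1 / 4 < ‖(⟨x, hxF⟩ : F) - z‖ := fun z hz =>
      hcon z (Finset.mem_map.2 ⟨z, hz, rfl⟩)
    have hnot : (⟨x, hxF⟩ : F) ∉ s := by
      intro hmem
      have := hfar _ hmem
      simp at this
      linarith
    have hmem : s.card + 1 ∈ S := by
      refine ⟨insert ⟨x, hxF⟩ s, Finset.card_insert_of_notMem hnot, ?_, ?_⟩
      · intro y hy
        rcases Finset.mem_insert.1 hy with rfl | hy
        · exact hx
        · exact h1 y hy
      · intro c hc d hd hcd
        rcases Finset.mem_insert.1 hc with rfl | hc <;> rcases Finset.mem_insert.1 hd with rfl | hd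
        · exact absurd rfl hcd
        · exact (hfar d hd).le
        · rw [norm_sub_rev]
          exact (hfar c hc).le
        · exact h2 c hc d hd hcd
    have := le_csSup hbdd hmem
    omega

/-- A quadratic form that is small on a `1/4`-net of the unit sphere of a subspace is small on the
whole subspace. -/
theorem abs_bilin_self_le_of_quarter_net {E : Type*} [NormedAddCommGroup E] [InnerProductSpace ℝ E]
    (F : Submodule ℝ E) [FiniteDimensional ℝ E] (B : E →ₗ[ℝ] E →ₗ[ℝ] ℝ)
    (hB : Continuous fun x => B x x) (s : Set E) (hs : ∀ y ∈ s, ‖y‖ = 1 ∧ y ∈ F)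
    (hnet : ∀ x ∈ F, ‖x‖ = 1 → ∃ y ∈ s, ‖x - y‖ ≤ 1 / 4) {ε : ℝ}
    (hε : ∀ y ∈ s, |B y y| ≤ ε) {x : E} (hx : x ∈ F) : |B x x| ≤ 4 * ε * ‖x‖ ^ 2 := by
  rcases eq_or_ne x 0 with rfl | hx0
  · simp
  have hnorm : ∀ z : E, z ≠ 0 → ‖‖z‖⁻¹ • z‖ = 1 := fun z hz => by
    rw [norm_smul, norm_inv, norm_norm, inv_mul_cancel₀ (norm_ne_zero_iff.2 hz)]
  have hcomp : IsCompact (Metric.sphere (0 : E) 1 ∩ F) :=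
    (isCompact_sphere 0 1).inter_right F.closed_of_finiteDimensional
  obtain ⟨x₀, ⟨hx₀n, hx₀F⟩, hmax⟩ := hcomp.exists_isMaxOn
    ⟨‖x‖⁻¹ • x, by simpa using hnorm x hx0, F.smul_mem _ hx⟩ (hB.abs.continuousOn)
  have hx₀n : ‖x₀‖ = 1 := by simpa using hx₀n
  set K := |B x₀ x₀| with hK
  have hbound : ∀ z ∈ F, |B z z| ≤ K * ‖z‖ ^ 2 := by
    intro z hz
    rcases eq_or_ne z 0 with rfl | hz0
    · simp
    have h1 : |B (‖z‖⁻¹ • z) (‖z‖⁻¹ • z)| ≤ K :=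
      hmax ⟨by simpa using hnorm z hz0, F.smul_mem _ hz⟩
    have h2 : 0 < ‖z‖ := norm_pos_iff.2 hz0
    simp only [map_smul, LinearMap.smul_apply, smul_eq_mul, abs_mul, abs_inv, abs_norm] at h1
    rw [← mul_assoc, ← mul_inv, inv_mul_le_iff₀ (by positivity)] at h1
    nlinarith
  obtain ⟨y, hy, hxy⟩ := hnet x₀ hx₀F hx₀n
  obtain ⟨hyn, hyF⟩ := hs y hy
  have hv : x₀ - y ∈ F := F.sub_mem hx₀F hyF
  have hw : x₀ + y ∈ F := F.add_mem hx₀F hyF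
  -- Polarisation, valid without symmetry of `B`. The weights 3 and 1/3 balance the small `x₀ - y`
  -- against the large `x₀ + y`, so the difference is at most `3/4 * K` and the maximum `K` absorbs
  -- it.
  have hid : B x₀ x₀ - B y y =
      (B ((3 : ℝ) • (x₀ - y) + (3⁻¹ : ℝ) • (x₀ + y)) ((3 : ℝ) • (x₀ - y) + (3⁻¹ : ℝ) • (x₀ + y)) -
        B ((3 : ℝ) • (x₀ - y) - (3⁻¹ : ℝ) • (x₀ + y))
          ((3 : ℝ) • (x₀ - y) - (3⁻¹ : ℝ) • (x₀ + y))) / 4 := by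
    simp only [map_add, map_sub, map_smul, LinearMap.add_apply, LinearMap.sub_apply,
      LinearMap.smul_apply, smul_eq_mul]
    ring
  have hnv : ‖(3 : ℝ) • (x₀ - y)‖ ≤ 3 / 4 := by
    rw [norm_smul, Real.norm_of_nonneg (by norm_num)]
    linarith
  have hnw : ‖(3⁻¹ : ℝ) • (x₀ + y)‖ ≤ 2 / 3 := by
    rw [norm_smul, Real.norm_of_nonneg (by norm_num)]
    have := norm_add_le x₀ y
    linarith
  have hK0 : 0 ≤ K := abs_nonneg _
  have hpar := parallelogram_law_with_norm ℝ ((3 : ℝ) • (x₀ - y)) ((3⁻¹ : ℝ) • (x₀ + y))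
  have h1 := hbound _ (F.add_mem (F.smul_mem (3 : ℝ) hv) (F.smul_mem (3⁻¹ : ℝ) hw))
  have h2 := hbound _ (F.sub_mem (F.smul_mem (3 : ℝ) hv) (F.smul_mem (3⁻¹ : ℝ) hw))
  have h3 := hε y hy
  generalize (3 : ℝ) • (x₀ - y) = v at *
  generalize (3⁻¹ : ℝ) • (x₀ + y) = w at *
  have hsum : ‖v + w‖ ^ 2 + ‖v - w‖ ^ 2 ≤ 3 := by
    nlinarith [norm_nonneg v, norm_nonneg w]
  have hdiff : |B x₀ x₀ - B y y| ≤ 3 / 4 * K := by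
    rw [hid, abs_div, abs_of_pos (by norm_num : (0 : ℝ) < 4), div_le_iff₀ (by norm_num)]
    calc |B (v + w) (v + w) - B (v - w) (v - w)|
        ≤ |B (v + w) (v + w)| + |B (v - w) (v - w)| := abs_sub _ _
      _ ≤ K * ‖v + w‖ ^ 2 + K * ‖v - w‖ ^ 2 := add_le_add h1 h2
      _ ≤ 3 / 4 * K * 4 := by nlinarith
  have hfin : K ≤ 4 * ε := by
    have := abs_sub_abs_le_abs_sub (B x₀ x₀) (B y y)
    linarith
  exact (hbound x hx).trans (by gcongr)

/-- The subspace of vectors supported on a coordinate set has dimension at most its size. -/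
theorem exists_submodule_of_support {n : ℕ} (T : Finset (Fin n)) :
    ∃ F : Submodule ℝ (EuclideanSpace ℝ (Fin n)), Module.finrank ℝ F ≤ T.card ∧
      ∀ x : EuclideanSpace ℝ (Fin n), (∀ i, x i ≠ 0 → i ∈ T) → x ∈ F := by
  classical
  refine ⟨Submodule.span ℝ (T.image fun i => EuclideanSpace.basisFun (Fin n) ℝ i),
    (finrank_span_finset_le_card _).trans Finset.card_image_le, fun x hx => ?_⟩
  rw [← (EuclideanSpace.basisFun (Fin n) ℝ).sum_repr x]
  refine Submodule.sum_mem _ fun i _ => ?_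
  by_cases hi : x i = 0
  · simp [hi]
  · refine Submodule.smul_mem _ _ (Submodule.subset_span ?_)
    exact Finset.mem_coe.2 (Finset.mem_image_of_mem _ (hx i hi))

/-- A small family of unit vectors controls every quadratic form on the set of sparse vectors. -/
theorem exists_net_sparseVectors {n k : ℕ} (hkn : k ≤ n) :
    ∃ s : Finset (EuclideanSpace ℝ (Fin n)), s.card ≤ n.choose k * 9 ^ k ∧ (∀ y ∈ s, ‖y‖ = 1) ∧
      ∀ B : EuclideanSpace ℝ (Fin n) →ₗ[ℝ] EuclideanSpace ℝ (Fin n) →ₗ[ℝ] ℝ,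
        (Continuous fun x => B x x) → ∀ ε : ℝ, (∀ y ∈ s, |B y y| ≤ ε) →
          ∀ x ∈ sparseVectors n k, |B x x| ≤ 4 * ε * ‖x‖ ^ 2 := by
  classical
  choose F hF hFmem using fun T : Finset (Fin n) => exists_submodule_of_support T
  choose s hcard hs hnet using fun T : Finset (Fin n) => exists_quarter_net_sphere (F T)
  refine ⟨(Finset.univ.powersetCard k).biUnion s, ?_, ?_, ?_⟩
  · refine (Finset.card_biUnion_le_card_mul _ _ (9 ^ k) fun T hT => ?_).trans ?_
    · refine (hcard T).trans (Nat.pow_le_pow_right (by norm_num) ((hF T).trans ?_))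
      exact (Finset.mem_powersetCard.1 hT).2.le
    · rw [Finset.card_powersetCard, Finset.card_univ, Fintype.card_fin]
  · intro y hy
    obtain ⟨T, -, hyT⟩ := Finset.mem_biUnion.1 hy
    exact (hs T y hyT).1
  · intro B hB ε hε x hx
    -- Padding the support to exactly `k` coordinates leaves only `n.choose k` subspaces.
    obtain ⟨T, hT, hTk⟩ := Finset.exists_superset_card_eq (n := k) hx (by simpa using hkn)
    have hTmem : T ∈ (Finset.univ : Finset (Fin n)).powersetCard k :=
      Finset.mem_powersetCard.2 ⟨Finset.subset_univ _, hTk⟩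
    refine abs_bilin_self_le_of_quarter_net (F T) B hB (s T) (hs T) (hnet T)
      (fun y hy => hε y (Finset.mem_biUnion.2 ⟨T, hTmem, hy⟩)) (hFmem T x fun i hi => ?_)
    exact hT (by simpa using hi)

/-! ### Entropy of the net -/

/-- Uses `n.choose k ≤ (e n / k) ^ k` and `9 ≤ e ^ 3`; hence `4 = 1 + 3`. -/
theorem choose_mul_nine_pow_le_exp {n k : ℕ} (hk : 1 ≤ k) :
    ((n.choose k * 9 ^ k : ℕ) : ℝ) ≤ Real.exp (k * (4 + Real.log (n / k))) := by
  have hk0 : (0 : ℝ) < k := by exact_mod_cast hk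
  rcases Nat.eq_zero_or_pos n with rfl | hn
  · rw [Nat.choose_eq_zero_of_lt (by omega)]
    simp only [zero_mul, Nat.cast_zero]
    positivity
  have hn0 : (0 : ℝ) < n := by exact_mod_cast hn
  have h9 : (9 : ℝ) ≤ Real.exp 3 := by
    have h1 := Real.exp_one_gt_d9
    have h2 : Real.exp 3 = Real.exp 1 ^ 3 := by rw [← Real.exp_nat_mul]; norm_num
    rw [h2]
    calc (9 : ℝ) ≤ 2.7 ^ 3 := by norm_num
      _ ≤ Real.exp 1 ^ 3 := by gcongr; linarith
  have hfact : (k : ℝ) ^ k / k.factorial ≤ Real.exp k := Real.pow_div_factorial_le_exp _ hk0.le k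
  have hfp : (0 : ℝ) < k.factorial := by exact_mod_cast Nat.factorial_pos k
  have hch : (n.choose k : ℝ) ≤ Real.exp k * (n / k) ^ k := by
    refine (Nat.choose_le_pow_div (α := ℝ) k n).trans ?_
    rw [div_pow, div_le_iff₀ hfp]
    rw [div_le_iff₀ hfp] at hfact
    have hkk : (0 : ℝ) < (k : ℝ) ^ k := by positivity
    calc (n : ℝ) ^ k = (k : ℝ) ^ k * ((n : ℝ) ^ k / (k : ℝ) ^ k) := by field_simp
      _ ≤ (Real.exp k * k.factorial) * ((n : ℝ) ^ k / (k : ℝ) ^ k) := by gcongr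
      _ = _ := by ring
  have hexp : Real.exp (k * (4 + Real.log (n / k))) =
      Real.exp k * (n / k) ^ k * (Real.exp 3) ^ k := by
    rw [show (k : ℝ) * (4 + Real.log (n / k)) = k + k * Real.log (n / k) + k * 3 by ring,
      Real.exp_add, Real.exp_add, Real.exp_nat_mul, Real.exp_nat_mul,
      Real.exp_log (by positivity)]
  rw [hexp]
  push_cast
  gcongr

/-- The sample size absorbs the entropy of the net. -/
theorem entropy_le_of_sample_size {n k m : ℕ} {δ : ℝ} (hk : 1 ≤ k) (hkn : k ≤ n) (hδ0 : 0 < δ)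
    (hδ1 : δ < 1) (h1 : 2 ^ 21 * δ⁻¹ ^ 2 * k * Real.log (n / (k * δ)) ≤ m)
    (h2 : 2 ^ 21 * (k : ℝ) ≤ m) :
    k * (4 + Real.log (n / k)) ≤ δ ^ 2 * m / 65536 := by
  have hk0 : (1 : ℝ) ≤ k := by exact_mod_cast hk
  have hkn' : (k : ℝ) ≤ n := by exact_mod_cast hkn
  have hn0 : (0 : ℝ) < n := by linarith
  have hlog : Real.log (n / (k * δ)) = Real.log (n / k) + Real.log δ⁻¹ := by
    rw [← Real.log_mul (by positivity) (by positivity)]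
    congr 1
    field_simp
  have hL : 0 ≤ Real.log (n / k) := Real.log_nonneg (by rw [le_div_iff₀ (by linarith)]; linarith)
  have hD : 0 ≤ Real.log δ⁻¹ := Real.log_nonneg (one_le_inv₀ hδ0 |>.2 hδ1.le)
  rw [hlog] at h1
  have h1' : 2 ^ 21 * k * (Real.log (n / k) + Real.log δ⁻¹) ≤ δ ^ 2 * m := by
    calc _ = δ ^ 2 * (2 ^ 21 * δ⁻¹ ^ 2 * k * (Real.log (n / k) + Real.log δ⁻¹)) := by
          field_simp
      _ ≤ _ := by gcongr
  -- Pays for the term `4 * k`. For `δ ≤ 1/2` the logarithm is at least `log 2`; for larger `δ` the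
  -- condition `C * k ≤ m` is needed.
  have hmain : 2 ^ 21 * (k : ℝ) * (1 / 4) ≤ δ ^ 2 * m := by
    rcases le_or_gt δ (1 / 2) with h | h
    · refine le_trans ?_ h1'
      have : Real.log 2 ≤ Real.log δ⁻¹ :=
        Real.log_le_log (by norm_num) (by rw [le_inv_comm₀ (by norm_num) hδ0]; linarith)
      have := Real.log_two_gt_d9
      gcongr
      linarith
    · have h4 : (1 / 4 : ℝ) ≤ δ ^ 2 := by nlinarith
      calc 2 ^ 21 * (k : ℝ) * (1 / 4) = (1 / 4) * (2 ^ 21 * k) := by ring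
        _ ≤ δ ^ 2 * m := by gcongr
  nlinarith [mul_nonneg (zero_le_one.trans hk0) hD, mul_nonneg (zero_le_one.trans hk0) hL]

/-! ### Bernstein's inequality -/

/-- Second-order Taylor remainder. The exponent `v / 4` is spent in halves: one bounds `y ^ 2`, the
other `exp |t * y|`. -/
theorem exp_mul_le_of_abs_le {t y v : ℝ} (ht : |t| ≤ 1 / 8) (hy : |y| ≤ v) :
    Real.exp (t * y) ≤ 1 + t * y + 128 * t ^ 2 * Real.exp (v / 4) := by
  have h1 : |Real.exp (t * y) - (1 + t * y)| ≤ |t * y| ^ 2 * Real.exp |t * y| := by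
    have := Complex.norm_exp_sub_sum_le_norm_mul_exp ((t * y : ℝ) : ℂ) 2
    rw [Complex.norm_real, Real.norm_eq_abs] at this
    have h2 : Complex.exp ((t * y : ℝ) : ℂ) -
        ∑ m ∈ Finset.range 2, ((t * y : ℝ) : ℂ) ^ m / (m.factorial : ℂ) =
          ((Real.exp (t * y) - (1 + t * y) : ℝ) : ℂ) := by
      simp [Finset.sum_range_succ]
    rwa [h2, Complex.norm_real, Real.norm_eq_abs] at this
  have h2 : |y| ^ 2 ≤ 128 * Real.exp (|y| / 8) := by
    have := Real.quadratic_le_exp_of_nonneg (x := |y| / 8) (by positivity)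
    nlinarith [abs_nonneg y]
  have h3 : |t * y| ≤ |y| / 8 := by
    rw [abs_mul]
    nlinarith [abs_nonneg y]
  have h4 : |t * y| ^ 2 * Real.exp |t * y| ≤ 128 * t ^ 2 * Real.exp (v / 4) := by
    calc |t * y| ^ 2 * Real.exp |t * y| ≤ |t * y| ^ 2 * Real.exp (|y| / 8) := by gcongr
      _ = t ^ 2 * |y| ^ 2 * Real.exp (|y| / 8) := by rw [abs_mul, mul_pow, sq_abs t]
      _ ≤ t ^ 2 * (128 * Real.exp (|y| / 8)) * Real.exp (|y| / 8) := by gcongr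
      _ = 128 * t ^ 2 * Real.exp (|y| / 4) := by
        rw [show |y| / 4 = |y| / 8 + |y| / 8 by ring, Real.exp_add]
        ring
      _ ≤ _ := by gcongr
  linarith [le_abs_self (Real.exp (t * y) - (1 + t * y))]

section Bernstein

variable {Ω : Type*} [MeasurableSpace Ω] {μ : Measure Ω}

theorem integrable_exp_mul_of_abs_le {Y V : Ω → ℝ} (hY : AEMeasurable Y μ) (hYV : ∀ ω, |Y ω| ≤ V ω)
    (hV : Integrable (fun ω => Real.exp (V ω / 4)) μ) {t : ℝ} (ht : |t| ≤ 1 / 8) :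
    Integrable (fun ω => Real.exp (t * Y ω)) μ := by
  refine hV.mono' (Real.measurable_exp.comp_aemeasurable (hY.const_mul t)).aestronglyMeasurable
    (Filter.Eventually.of_forall fun ω => ?_)
  rw [Real.norm_of_nonneg (Real.exp_pos _).le]
  refine Real.exp_le_exp.2 ((le_abs_self _).trans ?_)
  rw [abs_mul]
  nlinarith [abs_nonneg (Y ω), hYV ω]

variable [IsProbabilityMeasure μ]

/-- A centred random variable with a bounded exponential moment has a sub-Gaussian moment
generating function near the origin. -/
theorem mgf_le_exp_of_abs_le {Y V : Ω → ℝ} (hY : AEMeasurable Y μ) (hYV : ∀ ω, |Y ω| ≤ V ω)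
    (hV : Integrable (fun ω => Real.exp (V ω / 4)) μ) (hV4 : ∫ ω, Real.exp (V ω / 4) ∂μ ≤ 4)
    (hmean : ∫ ω, Y ω ∂μ = 0) {t : ℝ} (ht : |t| ≤ 1 / 8) :
    mgf Y μ t ≤ Real.exp (512 * t ^ 2) := by
  have hYint : Integrable Y μ := by
    refine (hV.const_mul 4).mono' hY.aestronglyMeasurable (Filter.Eventually.of_forall fun ω => ?_)
    have := Real.add_one_le_exp (V ω / 4)
    rw [Real.norm_eq_abs]
    linarith [hYV ω]
  calc mgf Y μ t = ∫ ω, Real.exp (t * Y ω) ∂μ := rfl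
    _ ≤ ∫ ω, (1 + t * Y ω + 128 * t ^ 2 * Real.exp (V ω / 4)) ∂μ :=
        integral_mono (integrable_exp_mul_of_abs_le hY hYV hV ht)
          (((integrable_const 1).add (hYint.const_mul t)).add (hV.const_mul _))
          fun ω => exp_mul_le_of_abs_le ht (hYV ω)
    _ = 1 + 128 * t ^ 2 * ∫ ω, Real.exp (V ω / 4) ∂μ := by
        have hlin : Integrable (fun ω => 1 + t * Y ω) μ :=
          (integrable_const 1).add (hYint.const_mul t)
        rw [integral_add hlin (hV.const_mul _),
          integral_add (integrable_const 1) (hYint.const_mul t), integral_const_mul,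
          integral_const_mul, hmean]
        simp
    _ ≤ 512 * t ^ 2 + 1 := by nlinarith [sq_nonneg t]
    _ ≤ Real.exp (512 * t ^ 2) := Real.add_one_le_exp _

/-- Chernoff's bound at `t = ε / 1024`, the minimiser of `512 * t ^ 2 - t * ε`; `ε ≤ 128` says that
`t ≤ 1/8`. -/
theorem measure_sum_ge_le_of_abs_le {m : ℕ} {Y V : Fin m → Ω → ℝ} (hind : iIndepFun Y μ)
    (hY : ∀ i, AEMeasurable (Y i) μ) (hYV : ∀ i ω, |Y i ω| ≤ V i ω)
    (hV : ∀ i, Integrable (fun ω => Real.exp (V i ω / 4)) μ)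
    (hV4 : ∀ i, ∫ ω, Real.exp (V i ω / 4) ∂μ ≤ 4)
    (hmean : ∀ i, ∫ ω, Y i ω ∂μ = 0) {ε : ℝ} (hε : 0 ≤ ε) (hε1 : ε ≤ 128) :
    μ.real {ω | m * ε ≤ ∑ i, Y i ω} ≤ Real.exp (-(m * ε ^ 2 / 2048)) := by
  have ht : |ε / 1024| ≤ 1 / 8 := by
    rw [abs_of_nonneg (by positivity)]
    linarith
  have hint : Integrable (fun ω => Real.exp (ε / 1024 * (∑ i, Y i) ω)) μ := by
    -- A non-integrable exponential would have `mgf` equal to the default 0, so positivity gives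
    -- integrability.
    rw [← mgf_pos_iff, hind.mgf_sum₀ hY]
    exact Finset.prod_pos fun i _ =>
      mgf_pos (integrable_exp_mul_of_abs_le (hY i) (hYV i) (hV i) ht)
  have h1 := measure_ge_le_exp_mul_mgf (X := ∑ i, Y i) (m * ε)
    (show 0 ≤ ε / 1024 by positivity) hint
  simp only [Finset.sum_apply] at h1
  refine h1.trans ?_
  rw [hind.mgf_sum₀ hY]
  calc _ ≤ Real.exp (-(ε / 1024) * (m * ε)) * ∏ _i : Fin m, Real.exp (512 * (ε / 1024) ^ 2) := by
        gcongr with i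
        · exact fun i _ => mgf_nonneg
        · exact mgf_le_exp_of_abs_le (hY i) (hYV i) (hV i) (hV4 i) (hmean i) ht
    _ = Real.exp (-(m * ε ^ 2 / 2048)) := by
        rw [Finset.prod_const, Finset.card_univ, Fintype.card_fin, ← Real.exp_nat_mul,
          ← Real.exp_add]
        congr 1
        ring

/-- A Bernstein inequality for independent centred random variables with bounded exponential
moments. -/
theorem measure_abs_sum_ge_le_of_abs_le {m : ℕ} {Y V : Fin m → Ω → ℝ} (hind : iIndepFun Y μ)
    (hY : ∀ i, AEMeasurable (Y i) μ) (hYV : ∀ i ω, |Y i ω| ≤ V i ω)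
    (hV : ∀ i, Integrable (fun ω => Real.exp (V i ω / 4)) μ)
    (hV4 : ∀ i, ∫ ω, Real.exp (V i ω / 4) ∂μ ≤ 4)
    (hmean : ∀ i, ∫ ω, Y i ω ∂μ = 0) {ε : ℝ} (hε : 0 ≤ ε) (hε1 : ε ≤ 128) :
    μ.real {ω | m * ε ≤ |∑ i, Y i ω|} ≤ 2 * Real.exp (-(m * ε ^ 2 / 2048)) := by
  have h1 := measure_sum_ge_le_of_abs_le hind hY hYV hV hV4 hmean hε hε1
  have h2 := measure_sum_ge_le_of_abs_le (Y := fun i ω => -Y i ω)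
    (hind.comp (fun _ y => -y) fun _ => measurable_neg) (fun i => (hY i).neg)
    (fun i ω => by rw [abs_neg]; exact hYV i ω) hV hV4
    (fun i => by rw [integral_neg, hmean i, neg_zero]) hε hε1
  have hsub : {ω | m * ε ≤ |∑ i, Y i ω|} ⊆
      {ω | m * ε ≤ ∑ i, Y i ω} ∪ {ω | m * ε ≤ ∑ i, -Y i ω} := by
    intro ω hω
    simp only [Set.mem_ofPred_eq, Set.mem_union, Finset.sum_neg_distrib] at hω ⊢
    exact le_abs.1 hω
  calc _ ≤ _ := measureReal_mono hsub
    _ ≤ _ := measureReal_union_le _ _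
    _ ≤ _ := by linarith

end Bernstein

/-! ### Independence of blocks -/

/-- Currying turns the product law on `ι × κ` into a product over `ι` of the laws of the rows. -/
theorem iIndepFun_curry {Ω ι κ 𝓧 : Type*} [MeasurableSpace Ω] [MeasurableSpace 𝓧] [Countable ι]
    [Countable κ] {μ : Measure Ω} {X : ι × κ → Ω → 𝓧} (hX : ∀ p, AEMeasurable (X p) μ)
    (h : iIndepFun X μ) : iIndepFun (fun i ω j => X (i, j) ω) μ := by
  have := h.isProbabilityMeasure
  have hprob : ∀ p, IsProbabilityMeasure (μ.map (X p)) := fun p =>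
    Measure.isProbabilityMeasure_map (hX p)
  have hprob' : ∀ i j, IsProbabilityMeasure (μ.map (X (i, j))) := fun i j => hprob (i, j)
  have hrow : ∀ i, iIndepFun (fun j => X (i, j)) μ := fun i =>
    h.precomp (Prod.mk_right_injective i)
  have hmeas : ∀ i, AEMeasurable (fun ω j => X (i, j) ω) μ := fun i =>
    aemeasurable_pi_lambda _ fun j => hX (i, j)
  have hXm : AEMeasurable (fun ω p => X p ω) μ := aemeasurable_pi_lambda _ hX
  rw [iIndepFun_iff_map_fun_eq_infinitePi_map₀' hmeas]
  have hcurry := Measure.infinitePi_map_curry (fun i j => μ.map (X (i, j)))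
  have hjoint := h.map_fun_eq_infinitePi_map₀' hX
  have hcomp : (fun ω i j => X (i, j) ω) =
      (MeasurableEquiv.curry ι κ 𝓧) ∘ fun ω p => X p ω := by
    ext; simp
  rw [hcomp, ← AEMeasurable.map_map_of_aemeasurable (MeasurableEquiv.measurable _).aemeasurable hXm,
    hjoint]
  refine hcurry.trans ?_
  congr 1
  ext1 i
  exact ((hrow i).map_fun_eq_infinitePi_map₀' fun j => hX (i, j)).symm

/-- Disjoint consecutive pairs of an independent family are independent. -/
theorem iIndepFun_consecutive_pairs {Ω 𝓧 : Type*} [MeasurableSpace Ω] [MeasurableSpace 𝓧]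
    {μ : Measure Ω} {m : ℕ} {a : Fin (2 * m) → Ω → 𝓧} (ha : ∀ j, AEMeasurable (a j) μ)
    (h : iIndepFun a μ) :
    iIndepFun (fun (i : Fin m) ω => (a ⟨2 * i, by omega⟩ ω, a ⟨2 * i + 1, by omega⟩ ω)) μ := by
  let g : Fin m × Fin 2 → Fin (2 * m) := fun p => ⟨2 * p.1 + p.2, by omega⟩
  have hg : Function.Injective g := by
    rintro ⟨i, j⟩ ⟨i', j'⟩ hij
    simp only [g, Fin.mk.injEq] at hij
    ext <;> simp <;> omega
  have h1 := iIndepFun_curry (X := fun p => a (g p)) (fun p => ha (g p)) (h.precomp hg)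
  exact h1.comp (fun _ v => (v 0, v 1)) fun _ => by fun_prop

/-! ### Signs and exchangeability -/

theorem measurable_real_sign : Measurable Real.sign := by
  unfold Real.sign
  exact Measurable.ite measurableSet_Iio measurable_const
    (Measurable.ite measurableSet_Ioi measurable_const measurable_const)

theorem abs_real_sign_le_one (r : ℝ) : |Real.sign r| ≤ 1 := by
  rcases Real.sign_apply_eq r with h | h | h <;> simp [h]

theorem real_sign_mul_self (r : ℝ) : Real.sign r * r = |r| := by
  rcases lt_trichotomy r 0 with h | rfl | h
  · rw [Real.sign_of_neg h, abs_of_neg h, neg_one_mul]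
  · simp
  · rw [Real.sign_of_pos h, abs_of_pos h, one_mul]

section Swap

variable {X : Type*} [MeasurableSpace X] {ν : Measure X} [IsProbabilityMeasure ν]

theorem measurable_integral_sign_sub {f : X → ℝ} (hf : Measurable f) :
    Measurable fun x => ∫ y, Real.sign (f x - f y) ∂ν := by
  have h : Measurable (Function.uncurry fun x y => Real.sign (f x - f y)) :=
    measurable_real_sign.comp ((hf.comp measurable_fst).sub (hf.comp measurable_snd))
  exact h.stronglyMeasurable.integral_prod_right.measurable

theorem abs_integral_sign_sub_le_one (f : X → ℝ) (r : ℝ) :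
    |∫ y, Real.sign (r - f y) ∂ν| ≤ 1 := by
  have := norm_integral_le_of_norm_le_const (μ := ν) (f := fun y => Real.sign (r - f y)) (C := 1)
    (Filter.Eventually.of_forall fun _ => abs_real_sign_le_one _)
  simpa using this

theorem integrable_sign_mul {Y : Type*} [MeasurableSpace Y] {ρ : Measure Y} {f g : Y → ℝ}
    (hf : Measurable f) (hg : Integrable g ρ) : Integrable (fun y => Real.sign (f y) * g y) ρ :=
  hg.bdd_mul (c := 1) (measurable_real_sign.comp hf).aestronglyMeasurable
    (Filter.Eventually.of_forall fun _ => abs_real_sign_le_one _)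

/-- Swapping the variables negates the integrand, also at ties, where `Real.sign` is 0. -/
theorem integral_integral_sign_sub {f : X → ℝ} (hf : Measurable f) :
    ∫ x, ∫ y, Real.sign (f x - f y) ∂ν ∂ν = 0 := by
  have hint : Integrable (fun p : X × X => Real.sign (f p.1 - f p.2)) (ν.prod ν) := by
    simpa using integrable_sign_mul (ρ := ν.prod ν)
      ((hf.comp measurable_fst).sub (hf.comp measurable_snd)) (integrable_const (1 : ℝ))
  have h1 := integral_prod _ hint
  have h2 := integral_prod_swap (μ := ν) (ν := ν) fun p : X × X => Real.sign (f p.1 - f p.2)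
  have h3 : ∀ p : X × X, Real.sign (f p.swap.1 - f p.swap.2) = -Real.sign (f p.1 - f p.2) :=
    fun p => by rw [← Real.sign_neg]; simp
  simp only [h3, integral_neg] at h2
  linarith

/-- The two halves of a sign-weighted difference contribute equally, by exchangeability. -/
theorem integral_sign_sub_mul_sub {f g : X → ℝ} (hf : Measurable f) (hg : Integrable g ν) :
    ∫ p : X × X, Real.sign (f p.1 - f p.2) * (g p.1 - g p.2) ∂(ν.prod ν) =
      2 * ∫ x, (∫ y, Real.sign (f x - f y) ∂ν) * g x ∂ν := by
  have hs : Measurable fun p : X × X => f p.1 - f p.2 :=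
    (hf.comp measurable_fst).sub (hf.comp measurable_snd)
  have hint1 : Integrable (fun p : X × X => Real.sign (f p.1 - f p.2) * g p.1) (ν.prod ν) :=
    integrable_sign_mul hs (hg.comp_fst ν)
  have hint2 : Integrable (fun p : X × X => Real.sign (f p.1 - f p.2) * g p.2) (ν.prod ν) :=
    integrable_sign_mul hs (hg.comp_snd ν)
  have h1 := integral_prod _ hint1
  have h2 := integral_prod_swap (μ := ν) (ν := ν)
    fun p : X × X => Real.sign (f p.1 - f p.2) * g p.2
  have h3 : ∀ p : X × X, Real.sign (f p.swap.1 - f p.swap.2) * g p.swap.2 =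
      -(Real.sign (f p.1 - f p.2) * g p.1) := fun p => by
    rw [← neg_mul, ← Real.sign_neg]; simp
  simp only [h3, integral_neg] at h2
  simp only [integral_mul_const] at h1
  simp only [mul_sub]
  rw [integral_sub hint1 hint2, ← h2, ← h1]
  ring

end Swap

/-! ### One-dimensional Gaussian integrals -/

section RealGaussian

theorem integral_abs_gaussianReal_two : ∫ x, |x| ∂(gaussianReal 0 2) = 2 / √Real.pi := by
  rw [integral_gaussianReal_eq_integral_smul (by norm_num)]
  have h1 : ∀ x : ℝ, gaussianPDFReal 0 2 x • |x| =
      (fun r : ℝ => (√(2 * Real.pi * 2))⁻¹ * (r ^ (1 : ℝ) * Real.exp (-(1 / 4) * r ^ (2 : ℝ)))) |x| := by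
    intro x
    simp only [gaussianPDFReal, smul_eq_mul, Real.rpow_one, Real.rpow_two, sq_abs, sub_zero]
    rw [show (((2 : NNReal) : ℝ)) = 2 from rfl, show -x ^ 2 / (2 * 2) = -(1 / 4) * x ^ 2 by ring]
    ring
  simp only [h1]
  rw [integral_comp_abs (f := fun r : ℝ => (√(2 * Real.pi * 2))⁻¹ *
    (r ^ (1 : ℝ) * Real.exp (-(1 / 4) * r ^ (2 : ℝ)))), integral_const_mul,
    integral_rpow_mul_exp_neg_mul_rpow (by norm_num) (by norm_num) (by norm_num)]
  have h2 : √(2 * Real.pi * 2) = 2 * √Real.pi := by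
    rw [show 2 * Real.pi * 2 = 2 ^ 2 * Real.pi by ring, Real.sqrt_mul (by norm_num),
      Real.sqrt_sq (by norm_num)]
  have h3 : ((1 / 4 : ℝ)) ^ (-(1 + 1 : ℝ) / 2) = 4 := by
    rw [show (-(1 + 1 : ℝ) / 2) = -1 by norm_num, Real.rpow_neg_one]
    norm_num
  rw [h2, h3, show ((1 : ℝ) + 1) / 2 = 1 by norm_num, Real.Gamma_one]
  have : √Real.pi ≠ 0 := (Real.sqrt_pos.2 Real.pi_pos).ne'
  field_simp
  norm_num

theorem integral_exp_sq_div_four_gaussianReal :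
    ∫ x, Real.exp (x ^ 2 / 4) ∂(gaussianReal 0 1) = √2 := by
  rw [integral_gaussianReal_eq_integral_smul (by norm_num)]
  have h1 : ∀ x : ℝ, gaussianPDFReal 0 1 x • Real.exp (x ^ 2 / 4) =
      (√(2 * Real.pi))⁻¹ * Real.exp (-(1 / 4) * x ^ 2) := by
    intro x
    simp only [gaussianPDFReal, smul_eq_mul, sub_zero, NNReal.coe_one, mul_one, mul_assoc]
    rw [← Real.exp_add]
    congr 2
    ring
  simp only [h1]
  rw [integral_const_mul, integral_gaussian, ← div_eq_inv_mul, ← Real.sqrt_div (by positivity)]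
  congr 1
  field_simp
  norm_num

theorem integrable_sq_gaussianReal : Integrable (fun x : ℝ => x ^ 2) (gaussianReal 0 1) :=
  (memLp_id_gaussianReal 2).integrable_sq

/-- Factor `X² - Y² = (X - Y)(X + Y)`: the factors are jointly Gaussian and uncorrelated, hence
independent, each of variance 2. -/
theorem integral_abs_sq_sub_sq_gaussianReal :
    ∫ p : ℝ × ℝ, |p.1 ^ 2 - p.2 ^ 2| ∂((gaussianReal 0 1).prod (gaussianReal 0 1)) =
      4 / Real.pi := by
  set P := (gaussianReal 0 1).prod (gaussianReal 0 1) with hP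
  have hX : HasLaw (Prod.fst : ℝ × ℝ → ℝ) (gaussianReal 0 1) P :=
    measurePreserving_fst.hasLaw
  have hY : HasLaw (Prod.snd : ℝ × ℝ → ℝ) (gaussianReal 0 1) P :=
    measurePreserving_snd.hasLaw
  have hXY : IndepFun (Prod.fst : ℝ × ℝ → ℝ) Prod.snd P := by
    rw [indepFun_iff_map_prod_eq_prod_map_map (by fun_prop) (by fun_prop), hX.map_eq, hY.map_eq]
    exact Measure.map_id
  have hXm : MemLp (Prod.fst : ℝ × ℝ → ℝ) 2 P := hX.hasGaussianLaw.memLp_two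
  have hYm : MemLp (Prod.snd : ℝ × ℝ → ℝ) 2 P := hY.hasGaussianLaw.memLp_two
  have hadd : HasLaw (fun p : ℝ × ℝ => p.1 + p.2) (gaussianReal 0 2) P := by
    refine ⟨by fun_prop, ?_⟩
    have := gaussianReal_add_gaussianReal_of_indepFun hXY hX.map_eq hY.map_eq
    rw [zero_add, one_add_one_eq_two] at this
    exact this
  have hsub : HasLaw (fun p : ℝ × ℝ => p.1 - p.2) (gaussianReal 0 2) P := by
    refine ⟨by fun_prop, ?_⟩
    have hYn : P.map (fun p : ℝ × ℝ => -p.2) = gaussianReal 0 1 := by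
      have := (gaussianReal_neg hY).map_eq
      rw [neg_zero] at this
      exact this
    have := gaussianReal_add_gaussianReal_of_indepFun (hXY.comp measurable_id measurable_neg)
      hX.map_eq hYn
    rw [zero_add, one_add_one_eq_two] at this
    exact this
  have hjoint : HasGaussianLaw (fun p : ℝ × ℝ => (p.1 - p.2, p.1 + p.2)) P := by
    have : HasGaussianLaw (fun p : ℝ × ℝ => (p.1, p.2)) P :=
      hXY.hasGaussianLaw hX.hasGaussianLaw hY.hasGaussianLaw
    exact this.map ((ContinuousLinearMap.fst ℝ ℝ ℝ - ContinuousLinearMap.snd ℝ ℝ ℝ).prod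
      (ContinuousLinearMap.fst ℝ ℝ ℝ + ContinuousLinearMap.snd ℝ ℝ ℝ))
  have hcov : cov[fun p : ℝ × ℝ => p.1 - p.2, fun p : ℝ × ℝ => p.1 + p.2; P] = 0 := by
    have h := covariance_sub_left (Z := fun p : ℝ × ℝ => p.1 + p.2) hXm hYm (hXm.add hYm)
    have h1 := covariance_add_right hXm hXm hYm
    have h2 := covariance_add_right hYm hXm hYm
    have hx : cov[(Prod.fst : ℝ × ℝ → ℝ), Prod.fst; P] = 1 := by
      rw [covariance_self (by fun_prop), hX.variance_eq, variance_id_gaussianReal]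
      simp
    have hy : cov[(Prod.snd : ℝ × ℝ → ℝ), Prod.snd; P] = 1 := by
      rw [covariance_self (by fun_prop), hY.variance_eq, variance_id_gaussianReal]
      simp
    have hc := covariance_comm (Prod.fst : ℝ × ℝ → ℝ) Prod.snd (μ := P)
    have hz := h.trans (congrArg₂ (· - ·) h1 h2)
    rw [hx, hy, hc] at hz
    refine hz.trans ?_
    ring
  have hind := hjoint.indepFun_of_covariance_eq_zero hcov
  have h1 : ∀ p : ℝ × ℝ, |p.1 ^ 2 - p.2 ^ 2| = |p.1 - p.2| * |p.1 + p.2| := fun p => by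
    rw [← abs_mul]
    ring_nf
  simp only [h1]
  rw [hind.integral_fun_comp_mul_comp (f := fun r => |r|) (g := fun r => |r|) (by fun_prop)
    (by fun_prop) (by fun_prop) (by fun_prop)]
  have e1 := hsub.integral_comp (f := fun r => |r|) (by fun_prop)
  have e2 := hadd.integral_comp (f := fun r => |r|) (by fun_prop)
  simp only [Function.comp_def] at e1 e2
  rw [e1, e2, integral_abs_gaussianReal_two, div_mul_div_comm, Real.mul_self_sqrt Real.pi_pos.le]
  norm_num

end RealGaussian

/-! ### Expectation of the sign product -/

section StdGaussian

variable {E : Type*} [NormedAddCommGroup E] [InnerProductSpace ℝ E] [FiniteDimensional ℝ E]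
  [MeasurableSpace E] [BorelSpace E]

theorem hasLaw_inner_stdGaussian {x : E} (hx : ‖x‖ = 1) :
    HasLaw (fun a : E => inner ℝ a x) (gaussianReal 0 1) (stdGaussian E) := by
  have h : (fun a : E => inner ℝ a x) = innerSL ℝ x := by
    ext a
    rw [innerSL_apply_apply, real_inner_comm]
  refine ⟨by fun_prop, ?_⟩
  rw [h, IsGaussian.map_eq_gaussianReal, integral_strongDual_stdGaussian,
    variance_dual_stdGaussian, innerSL_apply_norm, hx]
  simp

theorem hasGaussianLaw_inner_pair_stdGaussian (u w : E) :
    HasGaussianLaw (fun a : E => (inner ℝ a u, inner ℝ a w)) (stdGaussian E) := by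
  have h : (fun a : E => (inner ℝ a u, inner ℝ a w)) = (innerSL ℝ u).prod (innerSL ℝ w) := by
    ext a <;> simp [real_inner_comm]
  rw [h]
  exact (IsGaussian.hasGaussianLaw_id (μ := stdGaussian E)).map _

/-- Projections of a standard Gaussian vector onto orthogonal directions are independent. -/
theorem indepFun_inner_stdGaussian {u w : E} (huw : inner ℝ u w = 0) :
    IndepFun (fun a : E => inner ℝ a u) (fun a : E => inner ℝ a w) (stdGaussian E) := by
  refine (hasGaussianLaw_inner_pair_stdGaussian u w).indepFun_of_covariance_eq_zero ?_
  have h := covarianceBilin_apply_eq_cov (μ := stdGaussian E) IsGaussian.memLp_two_id u w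
  rw [covarianceBilin_stdGaussian, innerSL_apply_apply, huw] at h
  simpa only [real_inner_comm u, real_inner_comm w] using h.symm

theorem memLp_two_inner_stdGaussian (w : E) :
    MemLp (fun a : E => inner ℝ a w) 2 (stdGaussian E) :=
  (hasGaussianLaw_inner_pair_stdGaussian w w).fst.memLp_two

theorem integral_inner_stdGaussian (w : E) : ∫ a, inner ℝ a w ∂(stdGaussian E) = 0 := by
  have h := integral_strongDual_stdGaussian (innerSL ℝ w : StrongDual ℝ E)
  simpa only [innerSL_apply_apply, real_inner_comm w] using h

/-- The sign product embedding in expectation. -/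
theorem integral_sign_mul_sub_stdGaussian {u : E} (hu : ‖u‖ = 1) (x : E) :
    ∫ p : E × E, Real.sign ((inner ℝ p.1 u) ^ 2 - (inner ℝ p.2 u) ^ 2) *
      ((inner ℝ p.1 x) ^ 2 - (inner ℝ p.2 x) ^ 2) ∂((stdGaussian E).prod (stdGaussian E)) =
        4 / Real.pi * (inner ℝ u x) ^ 2 := by
  set ρ := inner ℝ u x with hρ
  set w := x - ρ • u with hw
  have huw : inner ℝ u w = 0 := by
    rw [hw, inner_sub_right, inner_smul_right, real_inner_self_eq_norm_sq, hu]
    simp [hρ]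
  have hlaw := hasLaw_inner_stdGaussian hu
  -- Conditional mean of the sign given the first projection `r` on `u`; as a function of that
  -- projection it is independent of the one on `w`.
  let h : ℝ → ℝ := fun r => ∫ y, Real.sign (r ^ 2 - y ^ 2) ∂(gaussianReal 0 1)
  have hmeas : Measurable h :=
    measurable_integral_sign_sub (ν := gaussianReal 0 1) (f := fun r : ℝ => r ^ 2) (by fun_prop)
  have hbdd : ∀ r, |h r| ≤ 1 := fun r => abs_integral_sign_sub_le_one _ _
  have hswap := integral_sign_sub_mul_sub (ν := stdGaussian E)
    (f := fun a : E => (inner ℝ a u) ^ 2) (g := fun a : E => (inner ℝ a x) ^ 2) (by fun_prop)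
    (memLp_two_inner_stdGaussian x).integrable_sq
  rw [hswap]
  have hinner : ∀ a : E, ∫ b, Real.sign ((inner ℝ a u) ^ 2 - (inner ℝ b u) ^ 2) ∂(stdGaussian E) =
      h (inner ℝ a u) := fun a =>
    hlaw.integral_comp (f := fun r => Real.sign ((inner ℝ a u) ^ 2 - r ^ 2))
      (measurable_real_sign.comp (by fun_prop)).aestronglyMeasurable
  simp only [hinner]
  have hdecomp : ∀ a : E, h (inner ℝ a u) * (inner ℝ a x) ^ 2 =
      ρ ^ 2 * (h (inner ℝ a u) * (inner ℝ a u) ^ 2) +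
        2 * ρ * (h (inner ℝ a u) * inner ℝ a u * inner ℝ a w) +
        h (inner ℝ a u) * (inner ℝ a w) ^ 2 := by
    intro a
    have : inner ℝ a x = ρ * inner ℝ a u + inner ℝ a w := by
      rw [hw, inner_sub_right, inner_smul_right]
      ring
    rw [this]
    ring
  simp only [hdecomp]
  have hb : ∀ {g : E → ℝ}, Integrable g (stdGaussian E) →
      Integrable (fun a => h (inner ℝ a u) * g a) (stdGaussian E) := fun hg =>
    hg.bdd_mul (c := 1) (hmeas.comp (by fun_prop)).aestronglyMeasurable
      (Filter.Eventually.of_forall fun a => hbdd _)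
  have hi1 := hb (memLp_two_inner_stdGaussian u).integrable_sq
  have hi2 : Integrable (fun a : E => h (inner ℝ a u) * inner ℝ a u * inner ℝ a w)
      (stdGaussian E) := by
    simp only [mul_assoc]
    exact hb ((memLp_two_inner_stdGaussian u).integrable_mul (memLp_two_inner_stdGaussian w))
  have hi3 := hb (memLp_two_inner_stdGaussian w).integrable_sq
  have hind := indepFun_inner_stdGaussian huw
  have hz : ∫ a, h (inner ℝ a u) ∂(stdGaussian E) = 0 := by
    refine (hlaw.integral_comp (f := h) hmeas.aestronglyMeasurable).trans ?_
    exact integral_integral_sign_sub (by fun_prop)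
  have h2 : ∫ a, h (inner ℝ a u) * inner ℝ a u * inner ℝ a w ∂(stdGaussian E) = 0 := by
    rw [hind.integral_fun_comp_mul_comp (f := fun r => h r * r) (g := fun r => r) (by fun_prop)
      (by fun_prop) (hmeas.mul measurable_id).aestronglyMeasurable (by fun_prop),
      integral_inner_stdGaussian, mul_zero]
  have h3 : ∫ a, h (inner ℝ a u) * (inner ℝ a w) ^ 2 ∂(stdGaussian E) = 0 := by
    rw [hind.integral_fun_comp_mul_comp (f := h) (g := fun r => r ^ 2) (by fun_prop)
      (by fun_prop) hmeas.aestronglyMeasurable (by fun_prop), hz, zero_mul]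
  have h1 : 2 * ∫ a, h (inner ℝ a u) * (inner ℝ a u) ^ 2 ∂(stdGaussian E) = 4 / Real.pi := by
    have hcomp : ∫ a, h (inner ℝ a u) * (inner ℝ a u) ^ 2 ∂(stdGaussian E) =
        ∫ r, h r * r ^ 2 ∂(gaussianReal 0 1) :=
      hlaw.integral_comp (f := fun r => h r * r ^ 2)
        (hmeas.mul (by fun_prop)).aestronglyMeasurable
    rw [hcomp, ← integral_abs_sq_sub_sq_gaussianReal,
      ← integral_sign_sub_mul_sub (ν := gaussianReal 0 1) (f := fun r : ℝ => r ^ 2)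
        (by fun_prop) integrable_sq_gaussianReal]
    refine integral_congr_ae (Filter.Eventually.of_forall fun p => ?_)
    exact real_sign_mul_self _
  have hi12 : Integrable (fun a : E => ρ ^ 2 * (h (inner ℝ a u) * (inner ℝ a u) ^ 2) +
      2 * ρ * (h (inner ℝ a u) * inner ℝ a u * inner ℝ a w)) (stdGaussian E) :=
    (hi1.const_mul _).add (hi2.const_mul _)
  rw [integral_add hi12 hi3, integral_add (hi1.const_mul _) (hi2.const_mul _), integral_const_mul, integral_const_mul, h2, h3,
    ← h1]
  ring

theorem integral_exp_sq_add_sq_stdGaussian {x : E} (hx : ‖x‖ = 1) :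
    ∫ p : E × E, Real.exp (((inner ℝ p.1 x) ^ 2 + (inner ℝ p.2 x) ^ 2) / 4)
      ∂((stdGaussian E).prod (stdGaussian E)) = 2 := by
  have h1 : ∫ a, Real.exp ((inner ℝ a x) ^ 2 / 4) ∂(stdGaussian E) = √2 := by
    rw [← integral_exp_sq_div_four_gaussianReal]
    exact (hasLaw_inner_stdGaussian hx).integral_comp (f := fun r => Real.exp (r ^ 2 / 4))
      (by fun_prop)
  simp only [add_div, Real.exp_add]
  rw [integral_prod_mul (fun a : E => Real.exp ((inner ℝ a x) ^ 2 / 4))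
    (fun a : E => Real.exp ((inner ℝ a x) ^ 2 / 4)), h1]
  norm_num

end StdGaussian

/-! ### Concentration and the union bound -/

/-- Concentration of the sign product embedding at a fixed unit vector. -/
theorem measure_abs_sum_sign_mul_sub_ge_le {E Ω : Type*} [NormedAddCommGroup E]
    [InnerProductSpace ℝ E] [FiniteDimensional ℝ E] [MeasurableSpace E] [BorelSpace E]
    [MeasurableSpace Ω] {μ : Measure Ω} [IsProbabilityMeasure μ] {m : ℕ}
    {a : Fin (2 * m) → Ω → E} (hind : iIndepFun a μ)
    (hlaw : ∀ j, HasLaw (a j) (stdGaussian E) μ) {u x : E} (hu : ‖u‖ = 1) (hx : ‖x‖ = 1)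
    {ε : ℝ} (hε : 0 ≤ ε) (hε1 : ε ≤ 128) :
    μ.real {ω | m * ε ≤ |∑ i : Fin m,
      (Real.sign ((inner ℝ (a ⟨2 * i, by omega⟩ ω) u) ^ 2 -
          (inner ℝ (a ⟨2 * i + 1, by omega⟩ ω) u) ^ 2) *
        ((inner ℝ (a ⟨2 * i, by omega⟩ ω) x) ^ 2 -
          (inner ℝ (a ⟨2 * i + 1, by omega⟩ ω) x) ^ 2) -
        4 / Real.pi * (inner ℝ u x) ^ 2)|} ≤ 2 * Real.exp (-(m * ε ^ 2 / 2048)) := by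
  have ham : ∀ j, AEMeasurable (a j) μ := fun j => (hlaw j).aemeasurable
  have hpair := iIndepFun_consecutive_pairs ham hind
  have hpairlaw : ∀ i : Fin m,
      HasLaw (fun ω => (a ⟨2 * i, by omega⟩ ω, a ⟨2 * i + 1, by omega⟩ ω))
        ((stdGaussian E).prod (stdGaussian E)) μ := fun i =>
    (hind.indepFun (by simp [Fin.ext_iff])).hasLaw_prod (hlaw _) (hlaw _)
  let f : E × E → ℝ := fun p => Real.sign ((inner ℝ p.1 u) ^ 2 - (inner ℝ p.2 u) ^ 2) *
    ((inner ℝ p.1 x) ^ 2 - (inner ℝ p.2 x) ^ 2) - 4 / Real.pi * (inner ℝ u x) ^ 2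
  -- The summand 2 dominates the mean, at most `4/π`. The exponential moment is then `2 * exp (1/2)
  -- ≤ 4`.
  let g : E × E → ℝ := fun p => (inner ℝ p.1 x) ^ 2 + (inner ℝ p.2 x) ^ 2 + 2
  have hf : Measurable f :=
    ((measurable_real_sign.comp (by fun_prop)).mul (by fun_prop)).sub_const _
  have hg : Measurable fun p => Real.exp (g p / 4) := by fun_prop
  have hux : (inner ℝ u x) ^ 2 ≤ 1 := by
    have := abs_real_inner_le_norm u x
    rw [hu, hx, one_mul] at this
    rw [← sq_abs]
    exact pow_le_one₀ (abs_nonneg _) this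
  have hfg : ∀ p, |f p| ≤ g p := by
    intro p
    have h1 : |Real.sign ((inner ℝ p.1 u) ^ 2 - (inner ℝ p.2 u) ^ 2) *
        ((inner ℝ p.1 x) ^ 2 - (inner ℝ p.2 x) ^ 2)| ≤ (inner ℝ p.1 x) ^ 2 + (inner ℝ p.2 x) ^ 2 := by
      rw [abs_mul]
      refine (mul_le_of_le_one_left (abs_nonneg _) (abs_real_sign_le_one _)).trans ?_
      rw [abs_le]
      constructor <;> nlinarith [sq_nonneg (inner ℝ p.1 x), sq_nonneg (inner ℝ p.2 x)]
    have h2 : |4 / Real.pi * (inner ℝ u x) ^ 2| ≤ 2 := by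
      rw [abs_of_nonneg (by positivity)]
      have : 4 / Real.pi ≤ 2 := by
        rw [div_le_iff₀ Real.pi_pos]
        linarith [Real.pi_gt_three]
      nlinarith [sq_nonneg (inner ℝ u x)]
    exact (abs_sub _ _).trans (add_le_add h1 h2)
  have hexp : ∫ p, Real.exp (g p / 4) ∂((stdGaussian E).prod (stdGaussian E)) =
      2 * Real.exp (1 / 2) := by
    have h := congrArg (· * Real.exp (1 / 2)) (integral_exp_sq_add_sq_stdGaussian hx)
    simp only [← integral_mul_const] at h
    refine Eq.trans ?_ h
    refine integral_congr_ae (Filter.Eventually.of_forall fun p => ?_)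
    simp only [g, ← Real.exp_add]
    ring_nf
  have hexp4 : 2 * Real.exp (1 / 2) ≤ 4 := by
    have h := Real.exp_one_lt_d9
    have h2 : Real.exp 1 = Real.exp (1 / 2) ^ 2 := by rw [← Real.exp_nat_mul]; norm_num
    nlinarith [Real.exp_pos (1 / 2)]
  have hfint : ∫ p, f p ∂((stdGaussian E).prod (stdGaussian E)) = 0 := by
    have hs2 : Integrable (fun p : E × E => (inner ℝ p.1 x) ^ 2 - (inner ℝ p.2 x) ^ 2)
        ((stdGaussian E).prod (stdGaussian E)) :=
      ((memLp_two_inner_stdGaussian x).integrable_sq.comp_fst _).sub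
        ((memLp_two_inner_stdGaussian x).integrable_sq.comp_snd _)
    simp only [f]
    rw [integral_sub (integrable_sign_mul (by fun_prop) hs2) (integrable_const _),
      integral_sign_mul_sub_stdGaussian hu]
    simp
  have hgint : ∀ i : Fin m, ∫ ω, Real.exp
      (g (a ⟨2 * i, by omega⟩ ω, a ⟨2 * i + 1, by omega⟩ ω) / 4) ∂μ = 2 * Real.exp (1 / 2) :=
    fun i => ((hpairlaw i).integral_comp hg.aestronglyMeasurable).trans hexp
  exact measure_abs_sum_ge_le_of_abs_le
    (Y := fun i ω => f (a ⟨2 * i, by omega⟩ ω, a ⟨2 * i + 1, by omega⟩ ω))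
    (V := fun i ω => g (a ⟨2 * i, by omega⟩ ω, a ⟨2 * i + 1, by omega⟩ ω))
    (hpair.comp (fun _ => f) fun _ => hf)
    (fun i => hf.comp_aemeasurable (hpairlaw i).aemeasurable) (fun i ω => hfg _)
    -- A non-integrable function would have integral 0.
    (fun i => Integrable.of_integral_ne_zero (by rw [hgint i]; positivity))
    (fun i => (hgint i).trans_le hexp4)
    (fun i => ((hpairlaw i).integral_comp hf.aestronglyMeasurable).trans hfint) hε hε1

/-- The error of the sign product embedding is a quadratic form. -/
theorem exists_bilin_sign_product_error {m n : ℕ} (a : Fin (2 * m) → EuclideanSpace ℝ (Fin n))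
    (u : EuclideanSpace ℝ (Fin n)) (s : Fin m → ℝ) (c : ℝ) :
    ∃ B : EuclideanSpace ℝ (Fin n) →ₗ[ℝ] EuclideanSpace ℝ (Fin n) →ₗ[ℝ] ℝ,
      ∀ x, B x x = c * (s ⬝ᵥ debiasedSketch a x) - (inner ℝ u x) ^ 2 := by
  let R : EuclideanSpace ℝ (Fin n) →
      EuclideanSpace ℝ (Fin n) →ₗ[ℝ] EuclideanSpace ℝ (Fin n) →ₗ[ℝ] ℝ :=
    fun p => (innerₗ _ p).smulRight (innerₗ _ p)
  have hR : ∀ p x, R p x x = (inner ℝ p x) ^ 2 := fun p x => by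
    simp [R, sq]
  refine ⟨c • ∑ i : Fin m, s i • (R (a ⟨2 * i, by omega⟩) - R (a ⟨2 * i + 1, by omega⟩)) - R u,
    fun x => ?_⟩
  simp [LinearMap.sum_apply, hR, dotProduct, debiasedSketch, quadSketch]

theorem theorem1 :
    ∃ C c : ℝ, 0 < C ∧ 0 < c ∧
      ∀ (n k m : ℕ) (δ : ℝ) (u : EuclideanSpace ℝ (Fin n)),
        1 ≤ k → k ≤ n → 0 < δ → δ < 1 → ‖u‖ = 1 →
        C * δ⁻¹ ^ 2 * k * Real.log (n / (k * δ)) ≤ m →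
        C * k ≤ m →
        ∀ {Ω : Type*} [MeasurableSpace Ω] (μ : Measure Ω) [IsProbabilityMeasure μ]
          (a : Fin (2 * m) → Ω → EuclideanSpace ℝ (Fin n)),
          iIndepFun a μ →
          (∀ j, HasLaw (a j) (stdGaussian (EuclideanSpace ℝ (Fin n))) μ) →
          1 - C * Real.exp (-c * δ ^ 2 * m) <
            μ.real {ω | ∀ x ∈ sparseVectors n k,
              |(Real.pi / 4) / m *
                  (signVec (debiasedSketch (fun j => a j ω) u) ⬝ᵥ
                    debiasedSketch (fun j => a j ω) x) -
                (inner ℝ u x) ^ 2| ≤ δ * ‖x‖ ^ 2} := by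
  -- Bernstein at `ε = δ / 4` has exponent `δ ^ 2 * m / 32768`; half of it pays for the net. The
  -- prefactor is 2, and `2 < C` makes the final inequality strict.
  refine ⟨2 ^ 21, 1 / 65536, by norm_num, by norm_num, ?_⟩
  intro n k m δ u hk hkn hδ0 hδ1 hu hm1 hm2 Ω _ μ _ a hind hlaw
  have hm : (0 : ℝ) < m := by
    have : (1 : ℝ) ≤ k := by exact_mod_cast hk
    linarith
  obtain ⟨s, hcard, hs, hnet⟩ := exists_net_sparseVectors hkn
  set G := {ω | ∀ x ∈ sparseVectors n k,
    |(Real.pi / 4) / m * (signVec (debiasedSketch (fun j => a j ω) u) ⬝ᵥ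
      debiasedSketch (fun j => a j ω) x) - (inner ℝ u x) ^ 2| ≤ δ * ‖x‖ ^ 2} with hG
  -- The threshold `δ / 4` offsets the factor 4 lost by the net.
  let bad : EuclideanSpace ℝ (Fin n) → Set Ω := fun y => {ω | m * (δ / 4) ≤ |∑ i : Fin m,
    (Real.sign ((inner ℝ (a ⟨2 * i, by omega⟩ ω) u) ^ 2 -
        (inner ℝ (a ⟨2 * i + 1, by omega⟩ ω) u) ^ 2) *
      ((inner ℝ (a ⟨2 * i, by omega⟩ ω) y) ^ 2 -
        (inner ℝ (a ⟨2 * i + 1, by omega⟩ ω) y) ^ 2) -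
      4 / Real.pi * (inner ℝ u y) ^ 2)|}
  have hbad : ∀ y ∈ s, μ.real (bad y) ≤ 2 * Real.exp (-(δ ^ 2 * m / 32768)) := by
    intro y hy
    refine (measure_abs_sum_sign_mul_sub_ge_le hind hlaw hu (hs y hy) (by positivity)
      (by linarith)).trans_eq ?_
    congr 2
    ring
  have hsub : Gᶜ ⊆ ⋃ y ∈ s, bad y := by
    intro ω hω
    by_contra hnot
    refine hω ?_
    obtain ⟨B, hB⟩ := exists_bilin_sign_product_error (fun j => a j ω) u
      (signVec (debiasedSketch (fun j => a j ω) u)) ((Real.pi / 4) / m)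
    have hcont : Continuous fun x => B x x := by
      simp only [hB, dotProduct, debiasedSketch, quadSketch]
      fun_prop
    intro x hx
    have hmain := hnet B hcont (δ / 4) ?_ x hx
    · rw [hB, mul_div_cancel₀ _ (by norm_num : (4 : ℝ) ≠ 0)] at hmain
      exact hmain
    intro y hy
    have hlt : ω ∉ bad y := fun hmem => hnot (Set.mem_iUnion₂.2 ⟨y, hy, hmem⟩)
    simp only [bad, Set.mem_ofPred_eq, not_le, Finset.sum_sub_distrib, Finset.sum_const,
      Finset.card_univ, Fintype.card_fin, nsmul_eq_mul] at hlt
    rw [hB]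
    simp only [dotProduct, signVec, debiasedSketch, quadSketch]
    generalize (∑ i : Fin m, (Real.sign _ * _) : ℝ) = S at hlt ⊢
    have hpi := Real.pi_pos
    have heq : Real.pi / 4 / m * S - (inner ℝ u y) ^ 2 =
        Real.pi / 4 / m * (S - m * (4 / Real.pi * (inner ℝ u y) ^ 2)) := by
      field_simp
    rw [heq, abs_mul, abs_of_pos (by positivity)]
    calc Real.pi / 4 / m * |S - m * (4 / Real.pi * (inner ℝ u y) ^ 2)|
        ≤ Real.pi / 4 / m * (m * (δ / 4)) := by gcongr
      _ = Real.pi / 4 * (δ / 4) := by field_simp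
      _ ≤ 1 * (δ / 4) := by
        gcongr
        linarith [Real.pi_le_four]
      _ = δ / 4 := one_mul _
  have hcompl : μ.real Gᶜ ≤ 2 * Real.exp (-(1 / 65536) * δ ^ 2 * m) := by
    calc μ.real Gᶜ ≤ μ.real (⋃ y ∈ s, bad y) := measureReal_mono hsub (measure_ne_top _ _)
      _ ≤ ∑ y ∈ s, μ.real (bad y) := measureReal_biUnion_finset_le _ _
      _ ≤ ∑ _y ∈ s, 2 * Real.exp (-(δ ^ 2 * m / 32768)) := Finset.sum_le_sum hbad
      _ = s.card * (2 * Real.exp (-(δ ^ 2 * m / 32768))) := by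
        rw [Finset.sum_const, nsmul_eq_mul]
      _ ≤ Real.exp (δ ^ 2 * m / 65536) * (2 * Real.exp (-(δ ^ 2 * m / 32768))) := by
        gcongr
        calc (s.card : ℝ) ≤ ((n.choose k * 9 ^ k : ℕ) : ℝ) := by exact_mod_cast hcard
          _ ≤ Real.exp (k * (4 + Real.log (n / k))) := choose_mul_nine_pow_le_exp hk
          _ ≤ _ := Real.exp_le_exp.2 (entropy_le_of_sample_size hk hkn hδ0 hδ1 hm1 hm2)
      _ = 2 * Real.exp (-(1 / 65536) * δ ^ 2 * m) := by
        rw [mul_left_comm, ← Real.exp_add]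
        congr 2
        ring
  -- Subadditivity suffices, so `G` need not be shown measurable.
  have hone : 1 ≤ μ.real G + μ.real Gᶜ := by
    have := measureReal_union_le (μ := μ) G Gᶜ
    rwa [Set.union_compl_self, probReal_univ] at this
  have := Real.exp_pos (-(1 / 65536) * δ ^ 2 * m)
  linarith
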